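/- Let $n\ge 0$ be an integer, let $q\in\mathbb{C}$ with $0<|q|<1$, and let $\alpha,\tau,a_1,a_2,b_1,b_2\in\mathbb{C}$ with $a_2\neq 0$. Put $t=q^\tau$ (complex powers of $q$ are taken with the principal branch). For $x,c\in\mathbb{C}$ and integers $0\le k\le m$ write $$(x;c)_m=\prod_{r=0}^{m-1}(1-c^r x),\qquad \begin{bmatrix} m\\ k\end{bmatrix}_c=\frac{(c;c)_m}{(c;c)_{m-k}\,(c;c)_k}.$$ Assume that the denominators below do not vanish, that is, $t^k\ne 1$ for $1\le k\le n$ and $q^\alpha a_1b_1t^m\neq 1$ for $0\le m\le 2n-2$. Let $L'_A=(l'_{ij})_{0\le i,j\le n}$ be the lower triangular matrix (it is the lower triangular factor in the Gauss decomposition $A=U'_AD'_AL'_A$ of the coefficient matrix $A$ of the $q$-difference system, with respect to the shift $\alpha\to\alpha+1$, for the Jackson integral of symmetric Selberg type) given by $l'_{ij}=0$ for $i<j$ and $$l'_{ij}=(-a_1a_2^{-1})^{i-j}\,t^{\binom{j}{2}-\binom{i}{2}}\begin{bmatrix} n-j\\ n-i\end{bmatrix}_t\frac{(a_2b_2t^j;t)_{i-j}}{(q^\alpha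 a_1b_1t^{2(n-i)};t)_{i-j}}\qquad (j\le i).$$ Then $L'_A$ is invertible, its inverse $(L'_A)^{-1}=(l'^{*}_{ij})_{0\le i,j\le n}$ is lower triangular, and for $0\le j\le i\le n$ $$l'^{*}_{ij}=\begin{bmatrix} n-j\\ n-i\end{bmatrix}_t\frac{(a_1a_2^{-1}t^{-j})^{i-j}\,(a_2b_2t^j;t)_{i-j}}{(q^\alpha a_1b_1t^{2n-i-j-1};t)_{i-j}}.$$ -/

import Mathlib

/-- The `c`-shifted factorial `(x; c)_m = (1 - x)(1 - c x) ⋯ (1 - c^(m-1) x)`, for `m ≥ 0`. -/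
noncomputable def shiftedFactorial (x c : ℂ) (m : ℕ) : ℂ :=
  ∏ k ∈ Finset.range m, (1 - c ^ k * x)

/-- The `c`-binomial coefficient `[m choose k]_c = (c; c)_m / ((c; c)_(m-k) (c; c)_k)`,
for `0 ≤ k ≤ m`. -/
noncomputable def cBinom (m k : ℕ) (c : ℂ) : ℂ :=
  shiftedFactorial c c m / (shiftedFactorial c c (m - k) * shiftedFactorial c c k)

/-- The lower triangular factor `L'_A` of the Gauss decomposition `A = U'_A D'_A L'_A`, where
`A` is the coefficient matrix of the `q`-difference system for `α → α + 1` and `t = q ^ τ`.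
For `j ≤ i` its `(i, j)` entry is
`(-a₁ a₂⁻¹)^(i-j) t^(C(j,2) - C(i,2)) [n-j choose n-i]_t (a₂ b₂ t^j; t)_(i-j) /
(q^α a₁ b₁ t^(2(n-i)); t)_(i-j)`. -/
noncomputable def LprimeA (n : ℕ) (q α τ a₁ a₂ b₁ b₂ : ℂ) :
    Matrix (Fin (n + 1)) (Fin (n + 1)) ℂ :=
  Matrix.of fun i j =>
    if j ≤ i then
      (-(a₁ * a₂⁻¹)) ^ ((i : ℕ) - (j : ℕ))
        * (q ^ τ) ^ (((j : ℕ).choose 2 : ℤ) - ((i : ℕ).choose 2 : ℤ))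
        * cBinom (n - (j : ℕ)) (n - (i : ℕ)) (q ^ τ)
        * shiftedFactorial (a₂ * b₂ * (q ^ τ) ^ (j : ℕ)) (q ^ τ) ((i : ℕ) - (j : ℕ))
        / shiftedFactorial (q ^ α * a₁ * b₁ * (q ^ τ) ^ (2 * (n - (i : ℕ)))) (q ^ τ)
            ((i : ℕ) - (j : ℕ))
    else 0

/-! It suffices to check a right inverse. Below the diagonal put i - j = d + 1, k = j + m and X =
q^α a₁ b₁ t^(2(n-i)). The two denominators of the k-th summand multiply to (X; t)_(2d+1) with a
block of d factors missing, so by `summand_eq` the summand is a factor free of m times (-1)^m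
t^C(m,2) [d+1 choose m]_t (X t^(d+1-m); t)_d. The last factor is a polynomial of degree at most d in
t^(-m), and a t-difference of order d + 1 annihilates it (`sum_gaussBinom_eval`). -/

theorem shiftedFactorial_zero (x c : ℂ) : shiftedFactorial x c 0 = 1 := by
  simp [shiftedFactorial]

theorem shiftedFactorial_succ (x c : ℂ) (m : ℕ) :
    shiftedFactorial x c (m + 1) = shiftedFactorial x c m * (1 - c ^ m * x) := by
  simp [shiftedFactorial, Finset.prod_range_succ]

theorem shiftedFactorial_add (x c : ℂ) (m k : ℕ) :
    shiftedFactorial x c (m + k) = shiftedFactorial x c m * shiftedFactorial (x * c ^ m) c k := by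
  simp only [shiftedFactorial, Finset.prod_range_add]
  congr 1
  refine Finset.prod_congr rfl fun r _ => ?_
  ring

theorem shiftedFactorial_ne_zero {x c : ℂ} {m : ℕ} (h : ∀ r < m, x * c ^ r ≠ 1) :
    shiftedFactorial x c m ≠ 0 := by
  refine Finset.prod_ne_zero_iff.2 fun r hr => sub_ne_zero.2 fun e => ?_
  exact h r (Finset.mem_range.1 hr) (by rw [mul_comm]; exact e.symm)

theorem cBinom_self {c : ℂ} {m : ℕ} (h : shiftedFactorial c c m ≠ 0) :
    cBinom m m c = 1 := by
  simp [cBinom, shiftedFactorial_zero, h]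

/-- Gaussian binomial coefficients, defined by the `c`-Pascal rule. -/
noncomputable def gaussBinom (c : ℂ) : ℕ → ℕ → ℂ
  | _, 0 => 1
  | 0, _ + 1 => 0
  | d + 1, m + 1 => gaussBinom c d (m + 1) + c ^ (d - m) * gaussBinom c d m

theorem gaussBinom_zero_right (c : ℂ) (d : ℕ) : gaussBinom c d 0 = 1 := by
  cases d <;> rfl

theorem gaussBinom_eq_zero (c : ℂ) {d m : ℕ} (h : d < m) : gaussBinom c d m = 0 := by
  induction d generalizing m with
  | zero => cases m with
    | zero => omega
    | succ m => rfl
  | succ d ih => cases m with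
    | zero => omega
    | succ m => rw [gaussBinom, ih (by omega), ih (by omega)]; simp

theorem gaussBinom_self (c : ℂ) (d : ℕ) : gaussBinom c d d = 1 := by
  induction d with
  | zero => rfl
  | succ d ih => rw [gaussBinom, gaussBinom_eq_zero c (Nat.lt_succ_self d), ih]; simp

theorem gaussBinom_add_mul (c : ℂ) (m e : ℕ) :
    gaussBinom c (m + e) m * (shiftedFactorial c c m * shiftedFactorial c c e) =
      shiftedFactorial c c (m + e) := by
  induction h : m + e generalizing m e with
  | zero =>
    obtain ⟨rfl, rfl⟩ : m = 0 ∧ e = 0 := by omega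
    simp [gaussBinom, shiftedFactorial_zero]
  | succ d ih =>
    cases m with
    | zero =>
      obtain rfl : e = d + 1 := by omega
      simp [gaussBinom, shiftedFactorial_zero]
    | succ m => cases e with
      | zero =>
        obtain rfl : m = d := by omega
        simp [gaussBinom_self, shiftedFactorial_zero]
      | succ e =>
        have h1 := ih (m + 1) e (by omega)
        have h2 := ih m (e + 1) (by omega)
        have hd : d - m = e + 1 := by omega
        have hd' : d = m + e + 1 := by omega
        rw [gaussBinom, hd, shiftedFactorial_succ c c d]
        rw [shiftedFactorial_succ c c m] at h1 ⊢
        rw [shiftedFactorial_succ c c e] at h2 ⊢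
        have hp : c ^ d = c ^ m * c ^ e * c := by rw [hd']; ring
        rw [hp]
        linear_combination (1 - c ^ e * c) * h1 + c ^ (e + 1) * (1 - c ^ m * c) * h2

/-- Pascal's rule and an index shift: the difference operator of order d + 1 is the one of order d
after g(m) ↦ g(m) - c^d g(m+1). -/
theorem sum_gaussBinom_succ (c : ℂ) (d : ℕ) (g : ℕ → ℂ) :
    ∑ m ∈ Finset.range (d + 2), (-1) ^ m * c ^ m.choose 2 * gaussBinom c (d + 1) m * g m =
      ∑ m ∈ Finset.range (d + 1),
        (-1) ^ m * c ^ m.choose 2 * gaussBinom c d m * (g m - c ^ d * g (m + 1)) := by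
  have key : ∀ m ∈ Finset.range (d + 1),
      (-1) ^ (m + 1) * c ^ (m + 1).choose 2 * gaussBinom c (d + 1) (m + 1) * g (m + 1) =
      (-1) ^ (m + 1) * c ^ (m + 1).choose 2 * gaussBinom c d (m + 1) * g (m + 1) -
      (-1) ^ m * c ^ m.choose 2 * gaussBinom c d m * (c ^ d * g (m + 1)) := by
    intro m hm
    have hd : c ^ d = c ^ m * c ^ (d - m) := by
      rw [← pow_add, Nat.add_sub_cancel' (Nat.lt_succ_iff.1 (Finset.mem_range.1 hm))]
    have hc : (m + 1).choose 2 = m.choose 2 + m := by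
      rw [Nat.choose_succ_succ' m 1, Nat.choose_one_right, add_comm]
    rw [gaussBinom, hd, hc]
    ring
  rw [Finset.sum_range_succ', Finset.sum_congr rfl key, Finset.sum_sub_distrib]
  simp only [mul_sub]
  rw [Finset.sum_sub_distrib,
    Finset.sum_range_succ' (fun m => (-1) ^ m * c ^ m.choose 2 * gaussBinom c d m * g m) d,
    Finset.sum_range_succ _ d, gaussBinom_eq_zero c (Nat.lt_succ_self d)]
  simp only [gaussBinom_zero_right]
  ring

theorem sum_gaussBinom_inv_pow {c : ℂ} (hc : c ≠ 0) {d p : ℕ} (hp : p < d) :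
    ∑ m ∈ Finset.range (d + 1),
      (-1) ^ m * c ^ m.choose 2 * gaussBinom c d m * (c⁻¹ ^ m) ^ p = 0 := by
  induction d with
  | zero => omega
  | succ d ih =>
    have key : ∀ m, (c⁻¹ ^ m) ^ p - c ^ d * (c⁻¹ ^ (m + 1)) ^ p =
        (c⁻¹ ^ m) ^ p * (1 - c ^ d * c⁻¹ ^ p) := fun m => by ring
    rw [sum_gaussBinom_succ c d fun m => (c⁻¹ ^ m) ^ p]
    simp only [key, ← mul_assoc]
    rw [← Finset.sum_mul]
    -- The new factor is 1 - c^(d-p), which vanishes exactly when needed, at p = d; smaller p fall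
    -- under induction.
    rcases Nat.lt_succ_iff_lt_or_eq.1 hp with h | rfl
    · rw [ih h, zero_mul]
    · rw [← mul_pow, mul_inv_cancel₀ hc]; simp

theorem sum_gaussBinom_eval {c : ℂ} (hc : c ≠ 0) {d : ℕ} (P : Polynomial ℂ)
    (hP : P.natDegree < d) :
    ∑ m ∈ Finset.range (d + 1),
      (-1) ^ m * c ^ m.choose 2 * gaussBinom c d m * P.eval (c⁻¹ ^ m) = 0 := by
  simp only [Polynomial.eval_eq_sum_range' hP, Finset.mul_sum]
  rw [Finset.sum_comm]
  refine Finset.sum_eq_zero fun p hp => ?_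
  rw [← mul_zero (P.coeff p), ← sum_gaussBinom_inv_pow hc (Finset.mem_range.1 hp), Finset.mul_sum]
  exact Finset.sum_congr rfl fun m _ => by ring

theorem sum_gaussBinom_shiftedFactorial {c : ℂ} (hc : c ≠ 0) (y : ℂ) (d : ℕ) :
    ∑ m ∈ Finset.range (d + 2), (-1) ^ m * c ^ m.choose 2 * gaussBinom c (d + 1) m *
      shiftedFactorial (y * c ^ (d + 1 - m)) c d = 0 := by
  -- The variable stands for c^(-m), since c^(d+1-m) = c^(d+1) c^(-m).
  let P : Polynomial ℂ := ∏ r ∈ Finset.range d,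
    (1 - Polynomial.C (c ^ r * (y * c ^ (d + 1))) * Polynomial.X)
  have hP : P.natDegree < d + 1 := by
    refine Nat.lt_succ_of_le ((Polynomial.natDegree_prod_le _ _).trans ?_)
    refine (Finset.sum_le_card_nsmul _ _ 1 fun r _ => ?_).trans (by simp)
    compute_degree
  rw [← sum_gaussBinom_eval hc P hP]
  refine Finset.sum_congr rfl fun m hm => ?_
  have hm' : m ≤ d + 1 := Nat.lt_succ_iff.1 (Finset.mem_range.1 hm)
  have : c ^ (d + 1 - m) = c ^ (d + 1) * c⁻¹ ^ m := by rw [pow_sub₀ c hc hm', inv_pow]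
  simp [P, shiftedFactorial, Polynomial.eval_prod, this, mul_assoc]

/-- Trinomial revision: all dependence on m for fixed e + m moves into one Gaussian binomial. -/
theorem cBinom_mul_cBinom {c : ℂ} {e m s : ℕ} (h : ∀ k ≤ e + m + s, shiftedFactorial c c k ≠ 0) :
    cBinom (e + s) s c * cBinom (e + m + s) (e + s) c =
      cBinom (e + m + s) s c * gaussBinom c (e + m) m := by
  have hg := gaussBinom_add_mul c m e
  rw [add_comm m e] at hg
  have h1 := h e (by omega)
  have h2 := h m (by omega)
  have h3 := h s (by omega)
  have h4 := h (e + s) (by omega)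
  have h5 := h (e + m) (by omega)
  rw [cBinom, cBinom, cBinom, show e + s - s = e by omega,
    show e + m + s - (e + s) = m by omega, show e + m + s - s = e + m by omega]
  field_simp
  rw [← hg]
  ring

theorem choose_two_add (j m : ℕ) :
    (j + m).choose 2 = j.choose 2 + m.choose 2 + j * m := by
  induction m with
  | zero => simp
  | succ m ih =>
    rw [← add_assoc, Nat.choose_succ_succ' (j + m) 1, Nat.choose_succ_succ' m 1, ih,
      Nat.choose_one_right, Nat.choose_one_right]
    ring

/-- The lower triangular matrix with the entries of the inverse of `LprimeA`. -/
noncomputable def LprimeAInv (n : ℕ) (q α τ a₁ a₂ b₁ b₂ : ℂ) :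
    Matrix (Fin (n + 1)) (Fin (n + 1)) ℂ :=
  Matrix.of fun i j =>
    if j ≤ i then
      cBinom (n - (j : ℕ)) (n - (i : ℕ)) (q ^ τ)
          * ((a₁ * a₂⁻¹ * (q ^ τ) ^ (-((j : ℕ) : ℤ))) ^ ((i : ℕ) - (j : ℕ))
            * shiftedFactorial (a₂ * b₂ * (q ^ τ) ^ (j : ℕ)) (q ^ τ) ((i : ℕ) - (j : ℕ)))
          / shiftedFactorial
              (q ^ α * a₁ * b₁ * (q ^ τ) ^ (2 * (n : ℤ) - ((i : ℕ) : ℤ) - ((j : ℕ) : ℤ) - 1))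
              (q ^ τ) ((i : ℕ) - (j : ℕ))
    else 0

/-- One summand of an entry of `LprimeA * LprimeAInv` strictly below the diagonal, where
`i = j + d + 1`, `k = j + m`, `d + 1 = e + m` and `n = i + s`. -/
theorem summand_eq {t : ℂ} (ht0 : t ≠ 0) (a B x : ℂ) {j d s e m : ℕ} (hd : e + m = d + 1)
    (hf : ∀ k ≤ e + m + s, shiftedFactorial t t k ≠ 0)
    (hx : shiftedFactorial (x * t ^ (2 * s)) t (2 * d + 1) ≠ 0) :
    ((-a) ^ e * t ^ (((j + m).choose 2 : ℤ) - ((j + d + 1).choose 2 : ℤ)) * cBinom (e + s) s t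
        * shiftedFactorial (B * t ^ (j + m)) t e / shiftedFactorial (x * t ^ (2 * s)) t e) *
      (cBinom (e + m + s) (e + s) t
        * ((a * t ^ (-(j : ℤ))) ^ m * shiftedFactorial (B * t ^ j) t m)
        / shiftedFactorial (x * t ^ (2 * s + d + e)) t m) =
    ((-a) ^ (d + 1) * t ^ ((j.choose 2 : ℤ) - ((j + d + 1).choose 2 : ℤ))
        * cBinom (e + m + s) s t * shiftedFactorial (B * t ^ j) t (d + 1)
        / shiftedFactorial (x * t ^ (2 * s)) t (2 * d + 1)) *
      ((-1) ^ m * t ^ m.choose 2 * gaussBinom t (d + 1) m *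
        shiftedFactorial (x * t ^ (2 * s) * t ^ (d + 1 - m)) t d) := by
  have hb := cBinom_mul_cBinom hf
  have hB : shiftedFactorial (B * t ^ j) t (d + 1) =
      shiftedFactorial (B * t ^ j) t m * shiftedFactorial (B * t ^ (j + m)) t e := by
    rw [← hd, add_comm e m, shiftedFactorial_add, mul_assoc, ← pow_add]
  -- The outer blocks, of lengths e and m, are the two denominators; the middle block becomes the
  -- polynomial factor.
  have hX : shiftedFactorial (x * t ^ (2 * s)) t (2 * d + 1) =
      shiftedFactorial (x * t ^ (2 * s)) t e *
        shiftedFactorial (x * t ^ (2 * s) * t ^ (d + 1 - m)) t d *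
        shiftedFactorial (x * t ^ (2 * s + d + e)) t m := by
    rw [show 2 * d + 1 = e + d + m by omega, shiftedFactorial_add, shiftedFactorial_add,
      show d + 1 - m = e by omega]
    congr 2
    ring
  have hpow : t ^ (((j + m).choose 2 : ℤ) - ((j + d + 1).choose 2 : ℤ)) *
      (t ^ (-(j : ℤ))) ^ m =
      t ^ ((j.choose 2 : ℤ) - ((j + d + 1).choose 2 : ℤ)) * t ^ m.choose 2 := by
    rw [← zpow_natCast (t ^ (-(j : ℤ))) m, ← zpow_mul, ← zpow_natCast t (m.choose 2),
      ← zpow_add₀ ht0, ← zpow_add₀ ht0, choose_two_add]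
    congr 1
    push_cast
    ring
  have hsgn : (-a) ^ e * a ^ m = (-a) ^ (d + 1) * (-1) ^ m := by
    rw [← hd, pow_add, mul_assoc, ← mul_pow]
    simp
  rw [hX] at hx
  have hx1 := left_ne_zero_of_mul (left_ne_zero_of_mul hx)
  have hx2 := right_ne_zero_of_mul (left_ne_zero_of_mul hx)
  have hx3 := right_ne_zero_of_mul hx
  rw [hd] at hb ⊢
  rw [hX, hB, div_mul_div_comm, div_mul_eq_mul_div, div_eq_div_iff (mul_ne_zero hx1 hx3) hx,
    mul_pow]
  set X1 := shiftedFactorial (x * t ^ (2 * s)) t e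
  set X2 := shiftedFactorial (x * t ^ (2 * s) * t ^ (d + 1 - m)) t d
  set X3 := shiftedFactorial (x * t ^ (2 * s + d + e)) t m
  set B1 := shiftedFactorial (B * t ^ j) t m
  set B2 := shiftedFactorial (B * t ^ (j + m)) t e
  calc _ = ((-a) ^ e * a ^ m) * (t ^ (((j + m).choose 2 : ℤ) - ((j + d + 1).choose 2 : ℤ)) *
      (t ^ (-(j : ℤ))) ^ m) * (cBinom (e + s) s t * cBinom (d + 1 + s) (e + s) t) *
      (B1 * B2 * X1 * X2 * X3) := by ring
    _ = _ := by rw [hsgn, hpow, hb]; ring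

theorem LprimeA_mul_LprimeAInv (n : ℕ) (q α τ a₁ a₂ b₁ b₂ : ℂ) (hq0 : q ≠ 0)
    (ht : ∀ k : ℕ, 1 ≤ k → k ≤ n → (q ^ τ) ^ k ≠ 1)
    (hden : ∀ m : ℕ, m + 2 ≤ 2 * n → q ^ α * a₁ * b₁ * (q ^ τ) ^ m ≠ 1) :
    LprimeA n q α τ a₁ a₂ b₁ b₂ * LprimeAInv n q α τ a₁ a₂ b₁ b₂ = 1 := by
  have ht0 : q ^ τ ≠ 0 := by simp [Complex.cpow_eq_zero_iff, hq0]
  have hf : ∀ k ≤ n, shiftedFactorial (q ^ τ) (q ^ τ) k ≠ 0 := fun k hk =>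
    shiftedFactorial_ne_zero fun r hr => by
      rw [← pow_succ']
      exact ht (r + 1) (by omega) (by omega)
  ext i j
  rw [Matrix.mul_apply]
  rcases lt_trichotomy i j with hij | rfl | hij
  · rw [Matrix.one_apply_ne hij.ne]
    refine Finset.sum_eq_zero fun k _ => ?_
    by_cases hk : k ≤ i
    · simp [LprimeAInv, not_le.2 (hk.trans_lt hij)]
    · simp [LprimeA, hk]
  · rw [Matrix.one_apply_eq, Finset.sum_eq_single i]
    · simp [LprimeA, LprimeAInv, shiftedFactorial_zero, cBinom_self (hf (n - i) (by omega))]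
    · intro k _ hk
      rcases lt_or_gt_of_ne hk with h | h
      · simp [LprimeAInv, not_le.2 h]
      · simp [LprimeA, not_le.2 h]
    · simp
  · rw [Matrix.one_apply_ne hij.ne']
    obtain ⟨i, hi⟩ := i
    obtain ⟨j, hj⟩ := j
    obtain ⟨d, rfl⟩ : ∃ d, i = j + d + 1 := Nat.exists_eq_add_of_lt hij
    obtain ⟨s, rfl⟩ : ∃ s, n = j + d + 1 + s := Nat.exists_eq_add_of_le (by omega)
    -- The exponents 2s + r are at most 2s + 2d = 2(n - j - 1) ≤ 2n - 2, the range of `hden`.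
    have hx : shiftedFactorial (q ^ α * a₁ * b₁ * (q ^ τ) ^ (2 * s)) (q ^ τ) (2 * d + 1) ≠ 0 :=
      shiftedFactorial_ne_zero fun r hr => by
        rw [mul_assoc, ← pow_add]
        exact hden _ (by omega)
    have hS := congrArg (fun z =>
      ((-(a₁ * a₂⁻¹)) ^ (d + 1) * (q ^ τ) ^ ((j.choose 2 : ℤ) - ((j + d + 1).choose 2 : ℤ))
        * cBinom (d + 1 + s) s (q ^ τ) * shiftedFactorial (a₂ * b₂ * (q ^ τ) ^ j) (q ^ τ) (d + 1)
        / shiftedFactorial (q ^ α * a₁ * b₁ * (q ^ τ) ^ (2 * s)) (q ^ τ) (2 * d + 1)) * z)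
      (sum_gaussBinom_shiftedFactorial ht0 (q ^ α * a₁ * b₁ * (q ^ τ) ^ (2 * s)) d)
    simp only [mul_zero] at hS
    rw [← hS, Finset.mul_sum, Finset.sum_range]
    symm
    -- By triangularity only the indices k = j + m with m ≤ d + 1 contribute.
    refine Finset.sum_of_injOn (fun m : Fin (d + 2) => ⟨j + m, by omega⟩) ?_ ?_ ?_ ?_
    · intro m _ m' _ h
      simpa [Fin.ext_iff] using h
    · simp
    · intro k _ hk
      by_cases h1 : (k : ℕ) ≤ j + d + 1
      · by_cases h2 : j ≤ (k : ℕ)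
        · refine absurd ⟨⟨k - j, by omega⟩, by simp, ?_⟩ hk
          simp [h2]
        · exact mul_eq_zero_of_right _ (if_neg h2)
      · exact mul_eq_zero_of_left (if_neg h1) _
    · intro m _
      obtain ⟨m, hm⟩ := m
      obtain ⟨e, he⟩ : ∃ e, e + m = d + 1 := ⟨d + 1 - m, by omega⟩
      have h1 : j + m ≤ j + d + 1 := by omega
      have h2 : j ≤ j + m := by omega
      simp only [LprimeA, LprimeAInv, Matrix.of_apply, Fin.le_def, if_pos h1, if_pos h2]
      have hz : (q ^ τ) ^ (2 * ((j + d + 1 + s : ℕ) : ℤ) - ((j + m : ℕ) : ℤ) - (j : ℤ) - 1) =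
          (q ^ τ) ^ (2 * s + d + e) := by
        rw [← zpow_natCast]
        congr 1
        omega
      rw [hz, show j + d + 1 - (j + m) = e by omega, show j + m - j = m by omega,
        show j + d + 1 + s - (j + d + 1) = s by omega,
        show j + d + 1 + s - (j + m) = e + s by omega,
        show j + d + 1 + s - j = e + m + s by omega,
        summand_eq ht0 _ _ _ he (fun k hk => hf k (by omega)) hx, he]

theorem propositionA4 (n : ℕ) (q α τ a₁ a₂ b₁ b₂ : ℂ)
    (hq0 : q ≠ 0) (hq1 : ‖q‖ < 1) (ha₂ : a₂ ≠ 0)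
    (ht : ∀ k : ℕ, 1 ≤ k → k ≤ n → (q ^ τ) ^ k ≠ 1)
    (hden : ∀ m : ℕ, m + 2 ≤ 2 * n → q ^ α * a₁ * b₁ * (q ^ τ) ^ m ≠ 1) :
    IsUnit (LprimeA n q α τ a₁ a₂ b₁ b₂) ∧
    (∀ i j : Fin (n + 1), i < j → (LprimeA n q α τ a₁ a₂ b₁ b₂)⁻¹ i j = 0) ∧
    (∀ i j : Fin (n + 1), j ≤ i →
      (LprimeA n q α τ a₁ a₂ b₁ b₂)⁻¹ i j =
        cBinom (n - (j : ℕ)) (n - (i : ℕ)) (q ^ τ)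
          * ((a₁ * a₂⁻¹ * (q ^ τ) ^ (-((j : ℕ) : ℤ))) ^ ((i : ℕ) - (j : ℕ))
            * shiftedFactorial (a₂ * b₂ * (q ^ τ) ^ (j : ℕ)) (q ^ τ) ((i : ℕ) - (j : ℕ)))
          / shiftedFactorial
              (q ^ α * a₁ * b₁ * (q ^ τ) ^ (2 * (n : ℤ) - ((i : ℕ) : ℤ) - ((j : ℕ) : ℤ) - 1))
              (q ^ τ) ((i : ℕ) - (j : ℕ))) := by
  have h := LprimeA_mul_LprimeAInv n q α τ a₁ a₂ b₁ b₂ hq0 ht hden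
  rw [Matrix.inv_eq_right_inv h]
  refine ⟨IsUnit.of_mul_eq_one _ h, fun i j hij => ?_, fun i j hij => ?_⟩
  · simp [LprimeAInv, not_le.2 hij]
  · simp [LprimeAInv, hij]
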